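/- Fix an algebraic closure $\overline{\mathbb Q}$ of $\mathbb Q$, and let $D_4\le S_4$ be the dihedral group of order $8$, acting on the four vertices of a square. A group is of generalized $D_4$-type if it is isomorphic to a quotient of a subdirect product of finitely many subgroups of $D_4$ that are transitive on the four vertices (a subdirect product of groups $T_1,\dots,T_n$ is a subgroup of $T_1\times\cdots\times T_n$ that projects onto every factor). A number field $K\subset\overline{\mathbb Q}$ with Galois closure $\widehat K$ over $\mathbb Q$ is of generalized $D_4$-type if $\operatorname{Gal}(\widehat K/\mathbb Q)$ is a group of generalized $D_4$-type, and $\mathbb Q(D_4^\infty)\subset\overline{\mathbb Q}$ denotes the compositum of all number fields of generalized $D_4$-type. For an elliptic curve $E/\mathbb Q$ write $E[n]=\{P\in E(\overline{\mathbb Q}) : nP=\mathcal O\}$ and, for a subfield $F\subseteq\overline{\mathbb Q}$, $E(F)[n]=E(F)\cap E[n]$. **Proposition.** Let $E/\mathbb Q$ be an elliptic curve. Then exactly one of the following holds: 1. $E(\mathbb Q(D_4^\infty))[2]$ is trivial; 2. $E[4]\subseteq E(\mathbb Q(D_4^\infty))$. Moreover, (2) holds if and only if $E(\mathbb Q)$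 contains a point of order $2$. -/

import Mathlib

/-- `S` is a subdirect product of the groups `T i`: a subgroup of the direct product whose
projection to every factor is surjective. -/
def IsSubdirectProduct {ι : Type*} {T : ι → Type*} [∀ i, Group (T i)]
    (S : Subgroup (∀ i, T i)) : Prop :=
  ∀ i, ∀ t : T i, ∃ s ∈ S, s i = t

/-- For a permutation group `G ≤ S_d`: the group `H` is of *generalized `G`-type* if it is
isomorphic to a quotient of (that is, is a homomorphic image of) a subdirect product of finitely
many subgroups of `G`, each acting transitively on the `d` points. -/
def IsGroupOfGeneralizedType {d : ℕ} (G : Subgroup (Equiv.Perm (Fin d)))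
    (H : Type*) [Group H] : Prop :=
  ∃ (n : ℕ) (T : Fin n → Subgroup (Equiv.Perm (Fin d))),
    (∀ i, T i ≤ G ∧ MulAction.IsPretransitive (T i) (Fin d)) ∧
    ∃ S : Subgroup (∀ i, T i), IsSubdirectProduct S ∧
      ∃ f : S →* H, Function.Surjective f

/-- A finite extension `K` of `k` inside an algebraic closure `Ω` of `k` (below, `k = ℚ`) is of
*generalized `G`-type* if the Galois group over `k` of its Galois closure is a group of generalized
`G`-type. -/
def IsFieldOfGeneralizedType {d : ℕ} (G : Subgroup (Equiv.Perm (Fin d)))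
    {k Ω : Type*} [Field k] [Field Ω] [Algebra k Ω] (K : IntermediateField k Ω) : Prop :=
  FiniteDimensional k K ∧
    IsGroupOfGeneralizedType G
      (IntermediateField.normalClosure k K Ω ≃ₐ[k] IntermediateField.normalClosure k K Ω)

/-- `k(G^∞)` inside `Ω`: the compositum of all finite extensions of `k` of generalized `G`-type. -/
def compositumOfGeneralizedType {d : ℕ} (G : Subgroup (Equiv.Perm (Fin d)))
    (k Ω : Type*) [Field k] [Field Ω] [Algebra k Ω] : IntermediateField k Ω :=
  sSup {K : IntermediateField k Ω | IsFieldOfGeneralizedType G K}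

/-- The dihedral group `D₄` of order 8 as a subgroup of `S₄`: the symmetries of a square with
vertices `0, 1, 2, 3` in cyclic order, generated by the rotation `(0 1 2 3)` and the reflection
`(0 2)`. -/
def dihedralD4 : Subgroup (Equiv.Perm (Fin 4)) :=
  Subgroup.closure {finRotate 4, Equiv.swap 0 2}

/-- The field `ℚ(D₄^∞)` inside an algebraic closure `Ω` of `ℚ`. -/
def fieldQD4Inf (Ω : Type*) [Field Ω] [Algebra ℚ Ω] : IntermediateField ℚ Ω :=
  compositumOfGeneralizedType dihedralD4 ℚ Ω

/-- For a Weierstrass curve `E` over `k` and an intermediate field `F` of `Ω / k`, the group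
`E(F)` of `F`-points, viewed as a subgroup of `E(Ω)`. -/
noncomputable def pointsOver {k Ω : Type*} [Field k] [Field Ω] [DecidableEq Ω] [Algebra k Ω]
    (E : WeierstrassCurve k) (F : IntermediateField k Ω) :
    AddSubgroup (E.toAffine.baseChange Ω).Point :=
  (WeierstrassCurve.Affine.Point.map (W' := E.toAffine) F.val).range

/-- The `n`-torsion subgroup `E[n] = {P ∈ E(Ω) : nP = 0}`, for `Ω` an algebraic closure of `k`. -/
noncomputable def torsionPoints {k : Type*} (Ω : Type*) [Field k] [Field Ω] [DecidableEq Ω]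
    [Algebra k Ω] (E : WeierstrassCurve k) (n : ℕ) :
    AddSubgroup (E.toAffine.baseChange Ω).Point :=
  AddSubgroup.torsionBy (E.toAffine.baseChange Ω).Point n

/-! Every element of D₄ is killed by 4, so fourth powers of Galois automorphisms act trivially on
ℚ(D₄^∞). A normal closure generated inside this field thus has a 2-group as Galois group, and no
element has degree 3. If E has no rational point of order 2, its two-division cubic is irreducible
over ℚ, so none of its roots, the abscissas of the points of order 2, lies in ℚ(D₄^∞).

Conversely, suppose the cubic has roots e ∈ ℚ and f, g. If the double of (x, y) has abscissa e, then
x - e is, up to sign, the product of square roots s, t of e - f and e - g, and 2y + a₁x + a₃ is also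
polynomial in s and t; the same holds at f and g. All these square roots satisfy T⁴ + pT² + q = 0
with p, q ∈ ℚ. Galois permutes the roots of such a polynomial compatibly with negation, hence
through D₄, so they lie in ℚ(D₄^∞) (`mem_compositumD4_of_biquadratic`), and with them all of E[4].
The two alternatives exclude each other because E[4] contains E[2] ≠ 0. -/

/-! ### Galois theory of fields of generalized G-type -/

section GeneralizedType

open IntermediateField

variable {k Ω : Type*} [Field k] [Field Ω] [Algebra k Ω]

/-- An automorphism all of whose conjugates fix `K` pointwise fixes its normal closure pointwise. -/
theorem fixes_normalClosure_of_conj [Normal k Ω] (K : IntermediateField k Ω) (σ : Ω ≃ₐ[k] Ω)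
    (h : ∀ τ : Ω ≃ₐ[k] Ω, ∀ x ∈ K, (τ⁻¹ * σ * τ) x = x) :
    ∀ x ∈ normalClosure k K Ω, σ x = x := by
  have hle : normalClosure k K Ω ≤ fixedField (Subgroup.zpowers σ) := by
    rw [normalClosure_def'']
    refine iSup_le fun τ => ?_
    rintro _ ⟨x, hx, rfl⟩
    rw [mem_fixedField_iff]
    intro f hf
    have hσ : σ • τ x = τ x := by
      have := congrArg τ (h τ x hx)
      simpa [AlgEquiv.mul_apply, AlgEquiv.aut_inv] using this
    have : Subgroup.zpowers σ ≤ MulAction.stabilizer (Ω ≃ₐ[k] Ω) (τ x) := by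
      rw [Subgroup.zpowers_le]
      exact hσ
    exact this hf
  intro x hx
  exact (mem_fixedField_iff _ _).1 (hle hx) σ (Subgroup.mem_zpowers σ)

/-- A field fixed by the kernel of a transitive permutation representation of the absolute Galois
group with image in `G` is of generalized `G`-type. -/
theorem isFieldOfGeneralizedType_of_hom [Normal k Ω] {d : ℕ} (G : Subgroup (Equiv.Perm (Fin d)))
    (K : IntermediateField k Ω) [FiniteDimensional k K] (φ : (Ω ≃ₐ[k] Ω) →* Equiv.Perm (Fin d))
    (hG : ∀ σ, φ σ ∈ G) (htrans : ∀ i j, ∃ σ, φ σ i = j)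
    (hker : ∀ σ, φ σ = 1 → ∀ x ∈ K, σ x = x) : IsFieldOfGeneralizedType G K := by
  refine ⟨inferInstance, 1, fun _ => φ.range, fun _ => ⟨?_, ⟨fun i j => ?_⟩⟩, ⊤, ?_, ?_⟩
  · rintro _ ⟨σ, rfl⟩
    exact hG σ
  · obtain ⟨σ, hσ⟩ := htrans i j
    exact ⟨⟨φ σ, σ, rfl⟩, hσ⟩
  · exact fun i t => ⟨fun _ => t, trivial, rfl⟩
  · let res := AlgEquiv.restrictNormalHom (F := k) (K₁ := Ω) (normalClosure k K Ω)
    -- The kernel of `φ` is normal, so all conjugates of its elements fix `K`. Restriction to the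
    -- normal closure therefore factors through the image of `φ`, and a single factor suffices as
    -- subdirect product.
    have hle : φ.rangeRestrict.ker ≤ res.ker := by
      intro σ hσ
      rw [MonoidHom.ker_rangeRestrict, MonoidHom.mem_ker] at hσ
      rw [MonoidHom.mem_ker]
      ext x
      have := fixes_normalClosure_of_conj K σ
        (fun τ => hker _ (by simp [hσ])) x x.2
      rw [AlgEquiv.restrictNormalHom_apply, this]
      rfl
    let ψ : φ.range →* Gal((normalClosure k K Ω)/k) :=
      φ.rangeRestrict.liftOfSurjective φ.rangeRestrict_surjective ⟨res, hle⟩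
    refine ⟨(ψ.comp (Pi.evalMonoidHom (fun _ : Fin 1 => φ.range) 0)).comp (Subgroup.subtype ⊤), ?_⟩
    intro g
    obtain ⟨σ, hσ⟩ := AlgEquiv.restrictNormalHom_surjective (F := k) (E := Ω)
      (K₁ := normalClosure k K Ω) g
    refine ⟨⟨fun _ => φ.rangeRestrict σ, trivial⟩, ?_⟩
    have : ψ (φ.rangeRestrict σ) = res σ :=
      MonoidHom.liftOfRightInverse_comp_apply _ _ _ ⟨res, hle⟩ σ
    exact this.trans hσ

/-- If every element of `G` is killed by `n`, the `n`-th power of any automorphism fixes the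
compositum of all fields of generalized `G`-type. -/
theorem pow_apply_eq_of_mem_compositum [Normal k Ω] {d n : ℕ} (G : Subgroup (Equiv.Perm (Fin d)))
    (hG : ∀ g ∈ G, g ^ n = 1) (σ : Ω ≃ₐ[k] Ω) {x : Ω}
    (hx : x ∈ compositumOfGeneralizedType G k Ω) : (σ ^ n) x = x := by
  have hle : compositumOfGeneralizedType G k Ω ≤ fixedField (Subgroup.zpowers (σ ^ n)) := by
    refine sSup_le ?_
    rintro K ⟨-, m, T, hT, S, -, f, hf⟩
    intro x hx
    let res := AlgEquiv.restrictNormalHom (F := k) (K₁ := Ω) (normalClosure k K Ω)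
    have hres : res (σ ^ n) = 1 := by
      obtain ⟨s, hs⟩ := hf (res σ)
      rw [map_pow, ← hs, ← map_pow]
      convert map_one f
      ext1
      funext i
      exact Subtype.ext (hG _ ((hT i).1 (s.1 i).2))
    have hfix : (σ ^ n) • x = x := by
      have := congrArg Subtype.val
        (DFunLike.congr_fun hres (⟨x, K.le_normalClosure hx⟩ : normalClosure k K Ω))
      rwa [AlgEquiv.restrictNormalHom_apply] at this
    rw [mem_fixedField_iff]
    intro f hf
    have : Subgroup.zpowers (σ ^ n) ≤ MulAction.stabilizer (Ω ≃ₐ[k] Ω) x := by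
      rw [Subgroup.zpowers_le]
      exact hfix
    exact this hf
  exact (mem_fixedField_iff _ _).1 (hle hx) _ (Subgroup.mem_zpowers _)

/-- An element fixed by all fourth powers of automorphisms does not have degree three. -/
theorem natDegree_minpoly_ne_three_of_pow_four [Algebra.IsSeparable k Ω] [Normal k Ω] {x : Ω}
    (hx : ∀ σ : Ω ≃ₐ[k] Ω, (σ ^ 4) x = x) : (minpoly k x).natDegree ≠ 3 := by
  intro h3
  have hint : IsIntegral k x := Algebra.IsIntegral.isIntegral x
  have : FiniteDimensional k k⟮x⟯ := adjoin.finiteDimensional hint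
  let N := normalClosure k k⟮x⟯ Ω
  have hfix : ∀ σ : Ω ≃ₐ[k] Ω, ∀ y ∈ k⟮x⟯, (σ ^ 4) y = y := by
    intro σ y hy
    have hle : k⟮x⟯ ≤ fixedField (Subgroup.zpowers (σ ^ 4)) := by
      rw [adjoin_simple_le_iff, mem_fixedField_iff]
      intro f hf
      have : Subgroup.zpowers (σ ^ 4) ≤ MulAction.stabilizer (Ω ≃ₐ[k] Ω) x := by
        rw [Subgroup.zpowers_le]
        exact hx σ
      exact this hf
    exact (mem_fixedField_iff _ _).1 (hle hy) _ (Subgroup.mem_zpowers _)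
  -- A conjugate of a fourth power is again a fourth power, so the Galois group of the normal
  -- closure has exponent dividing 4.
  have hp : IsPGroup 2 Gal(N/k) := by
    intro g
    refine ⟨2, ?_⟩
    obtain ⟨σ, rfl⟩ := AlgEquiv.restrictNormalHom_surjective (F := k) (E := Ω) (K₁ := N) g
    rw [← map_pow]
    ext y
    rw [AlgEquiv.restrictNormalHom_apply]
    refine fixes_normalClosure_of_conj k⟮x⟯ (σ ^ 2 ^ 2) (fun τ z hz => ?_) y y.2
    have : τ⁻¹ * σ ^ 2 ^ 2 * τ = (τ⁻¹ * σ * τ) ^ 4 := by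
      simpa using (conj_pow (i := 4) (a := τ⁻¹) (b := σ)).symm
    rw [this]
    exact hfix _ z hz
  have : Fact (Nat.Prime 2) := ⟨Nat.prime_two⟩
  obtain ⟨n, hn⟩ := IsPGroup.iff_card.1 hp
  have : IsGalois k N := {}
  rw [IsGalois.card_aut_eq_finrank] at hn
  have hdvd : Module.finrank k k⟮x⟯ ∣ Module.finrank k N :=
    finrank_dvd_of_le_right (k⟮x⟯).le_normalClosure
  rw [adjoin.finrank hint, h3, hn] at hdvd
  have := Nat.Prime.dvd_of_dvd_pow Nat.prime_three hdvd
  omega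

theorem le_compositumOfGeneralizedType {d : ℕ} {G : Subgroup (Equiv.Perm (Fin d))}
    {K : IntermediateField k Ω} (hK : IsFieldOfGeneralizedType G K) :
    K ≤ compositumOfGeneralizedType G k Ω :=
  le_sSup hK

end GeneralizedType

/-! ### Quadratic and biquadratic elements in the D₄-compositum -/

section DihedralFour

open IntermediateField Polynomial

theorem pow_four_eq_one_of_mem_dihedralD4 : ∀ g ∈ dihedralD4, g ^ 4 = 1 := by
  -- The half turn is central in D₄, and its centralizer in S₄ is small enough to exclude 3-cycles;
  -- the rest is a finite check.
  have hle : dihedralD4 ≤ Subgroup.centralizer {finRotate 4 ^ 2} := by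
    rw [dihedralD4, Subgroup.closure_le]
    rintro g (rfl | rfl) <;> rw [SetLike.mem_coe, Subgroup.mem_centralizer_iff] <;>
      rintro _ rfl <;> decide
  have key : ∀ g : Equiv.Perm (Fin 4), finRotate 4 ^ 2 * g = g * finRotate 4 ^ 2 → g ^ 4 = 1 := by
    set_option maxRecDepth 4000 in decide
  exact fun g hg => key g (Subgroup.mem_centralizer_iff.1 (hle hg) _ rfl)

/-- The map `i ↦ i + 2` is the half turn of the square, and D₄ is its full centralizer in S₄. -/
theorem mem_dihedralD4_of_add_two (g : Equiv.Perm (Fin 4)) (hg : ∀ i, g (i + 2) = g i + 2) :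
    g ∈ dihedralD4 := by
  have key : ∀ g : Equiv.Perm (Fin 4), (∀ i, g (i + 2) = g i + 2) →
      ∃ a : Fin 4, ∃ b : Fin 2, g = finRotate 4 ^ (a : ℕ) * Equiv.swap 0 2 ^ (b : ℕ) := by
    decide
  obtain ⟨a, b, rfl⟩ := key g hg
  exact mul_mem (pow_mem (Subgroup.subset_closure (by simp)) _)
    (pow_mem (Subgroup.subset_closure (by simp)) _)

/-- A group of order 2 is too small to be transitive on four points, but it is a quotient of the
rotation group C₄, which is transitive. -/
theorem isGroupOfGeneralizedType_dihedralD4_of_card_eq_two {H : Type*} [Group H]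
    (hH : Nat.card H = 2) : IsGroupOfGeneralizedType dihedralD4 H := by
  have hcyc : IsCyclic H := by
    have : Fact (Nat.Prime 2) := ⟨Nat.prime_two⟩
    exact isCyclic_of_prime_card hH
  obtain ⟨h, hh⟩ := hcyc.exists_generator
  let r : Subgroup.zpowers (finRotate 4) := ⟨finRotate 4, Subgroup.mem_zpowers _⟩
  have hr : ∀ x, x ∈ Subgroup.zpowers r := by
    rintro ⟨_, n, rfl⟩
    exact ⟨n, rfl⟩
  have hord : orderOf h ∣ orderOf r := by
    rw [orderOf_eq_card_of_forall_mem_zpowers hh, hH]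
    by_contra hodd
    have h4 : r ^ 4 = 1 := Subtype.ext (by decide)
    have h2 : r ^ 2 ≠ 1 := fun h => absurd (congrArg Subtype.val h) (by decide)
    have := (Nat.dvd_prime_pow Nat.prime_two (m := 2)).1 (orderOf_dvd_of_pow_eq_one h4)
    obtain ⟨j, -, hj⟩ := this
    rcases j with _ | j
    · rw [pow_zero, orderOf_eq_one_iff] at hj
      exact h2 (by rw [hj, one_pow])
    · exact hodd (hj ▸ dvd_pow_self 2 j.succ_ne_zero)
  let f := monoidHomOfForallMemZpowers hr hord
  refine ⟨1, fun _ => Subgroup.zpowers (finRotate 4), fun _ => ⟨?_, ⟨?_⟩⟩, ⊤,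
    fun i t => ⟨fun _ => t, trivial, rfl⟩,
    (f.comp (Pi.evalMonoidHom (fun _ : Fin 1 => Subgroup.zpowers (finRotate 4)) 0)).comp
      (Subgroup.subtype ⊤), ?_⟩
  · rw [Subgroup.zpowers_le]
    exact Subgroup.subset_closure (by simp)
  · have key : ∀ i j : Fin 4, ∃ a : Fin 4, (finRotate 4 ^ (a : ℕ)) i = j := by decide
    intro i j
    obtain ⟨a, ha⟩ := key i j
    exact ⟨⟨finRotate 4 ^ (a : ℕ), pow_mem (Subgroup.mem_zpowers _) _⟩, ha⟩
  · intro y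
    obtain ⟨n, rfl⟩ := hh y
    refine ⟨⟨fun _ => r ^ n, trivial⟩, ?_⟩
    change f (r ^ n) = h ^ n
    rw [map_zpow, monoidHomOfForallMemZpowers_apply_gen]

section Biquadratic

variable {k Ω : Type*} [Field k] [Field Ω] [Algebra k Ω]

theorem IsAlgClosure.normal_of_field [IsAlgClosure k Ω] : Normal k Ω := by
  have : IsAlgClosed Ω := IsAlgClosure.isAlgClosed k
  have : Algebra.IsAlgebraic k Ω := IsAlgClosure.isAlgebraic
  exact normal_iff.2 fun y => ⟨Algebra.IsIntegral.isIntegral y, IsAlgClosed.splits _⟩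

/-- Since `x ^ 2` has degree exactly 2, the degree of `x` is even and at most 4. Degree 4 gives the
irreducible case, where Galois is transitive on the roots. -/
theorem natDegree_minpoly_le_two_or_eq_of_biquadratic {x : Ω} {p q : k}
    (hquad : ¬∃ c : k, x ^ 2 = algebraMap k Ω c) (hint : IsIntegral k x)
    (h : x ^ 4 + algebraMap k Ω p * x ^ 2 + algebraMap k Ω q = 0) :
    (minpoly k x).natDegree ≤ 2 ∨ minpoly k x = X ^ 4 + C p * X ^ 2 + C q := by
  have hd : (X ^ 4 + C p * X ^ 2 + C q : k[X]).natDegree = 4 := by compute_degree!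
  have hmon : (X ^ 4 + C p * X ^ 2 + C q : k[X]).Monic := by monicity!
  have hdvd4 : minpoly k x ∣ X ^ 4 + C p * X ^ 2 + C q := minpoly.dvd k x (by simpa using h)
  have hd2 : (X ^ 2 + C p * X + C q : k[X]).natDegree = 2 := by compute_degree!
  have h0 : (X ^ 2 + C p * X + C q : k[X]) ≠ 0 := by
    intro h0
    rw [h0] at hd2
    simp at hd2
  have hle2 : (minpoly k (x ^ 2)).natDegree ≤ 2 :=
    (natDegree_le_of_dvd (minpoly.dvd k (x ^ 2) (by
      simp only [map_add, map_mul, map_pow, aeval_X, aeval_C]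
      linear_combination h)) h0).trans_eq hd2
  have hne1 : (minpoly k (x ^ 2)).natDegree ≠ 1 := fun h1 => by
    obtain ⟨c, hc⟩ := minpoly.natDegree_eq_one_iff.1 h1
    exact hquad ⟨c, hc.symm⟩
  have hpos := minpoly.natDegree_pos (hint.pow 2)
  have hdvd : Module.finrank k k⟮x ^ 2⟯ ∣ Module.finrank k k⟮x⟯ := by
    have hle : k⟮x ^ 2⟯ ≤ k⟮x⟯ :=
      adjoin_simple_le_iff.2 (pow_mem (mem_adjoin_simple_self k x) 2)
    exact finrank_dvd_of_le_right hle
  rw [adjoin.finrank hint, adjoin.finrank (hint.pow 2)] at hdvd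
  have hle4 : (minpoly k x).natDegree ≤ 4 := (natDegree_le_of_dvd hdvd4 hmon.ne_zero).trans_eq hd
  have h2 : (minpoly k (x ^ 2)).natDegree = 2 := by omega
  rw [h2] at hdvd
  obtain hle | heq : (minpoly k x).natDegree ≤ 2 ∨ (minpoly k x).natDegree = 4 := by omega
  · exact Or.inl hle
  · exact Or.inr (eq_of_monic_of_dvd_of_natDegree_le (minpoly.monic hint) hmon hdvd4
      (by rw [hd, heq])).symm

end Biquadratic

variable {k Ω : Type*} [Field k] [CharZero k] [Field Ω] [Algebra k Ω]

theorem mem_compositumD4_of_natDegree_minpoly_le_two [Normal k Ω] {x : Ω}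
    (h : (minpoly k x).natDegree ≤ 2) : x ∈ compositumOfGeneralizedType dihedralD4 k Ω := by
  have hint : IsIntegral k x := Algebra.IsIntegral.isIntegral x
  have hpos := minpoly.natDegree_pos hint
  obtain h1 | h2 : (minpoly k x).natDegree = 1 ∨ (minpoly k x).natDegree = 2 := by omega
  · obtain ⟨q, rfl⟩ := minpoly.natDegree_eq_one_iff.1 h1
    exact IntermediateField.algebraMap_mem _ q
  · have : FiniteDimensional k k⟮x⟯ := adjoin.finiteDimensional hint
    have hfin : Module.finrank k k⟮x⟯ = 2 := by rw [adjoin.finrank hint, h2]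
    have : Algebra.IsQuadraticExtension k k⟮x⟯ := ⟨hfin⟩
    refine le_compositumOfGeneralizedType (K := k⟮x⟯) ⟨inferInstance, ?_⟩ (mem_adjoin_simple_self k x)
    rw [normalClosure_of_normal]
    apply isGroupOfGeneralizedType_dihedralD4_of_card_eq_two
    rw [IsGalois.card_aut_eq_finrank, hfin]

theorem mem_compositumD4_of_quadratic [Normal k Ω] {x : Ω} (p q : k)
    (h : x ^ 2 + algebraMap k Ω p * x + algebraMap k Ω q = 0) : x ∈ compositumOfGeneralizedType dihedralD4 k Ω := by
  apply mem_compositumD4_of_natDegree_minpoly_le_two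
  have hd : (X ^ 2 + C p * X + C q : k[X]).natDegree = 2 := by compute_degree!
  have h0 : (X ^ 2 + C p * X + C q : k[X]) ≠ 0 := by
    intro h0
    rw [h0] at hd
    simp at hd
  exact (natDegree_le_of_dvd (minpoly.dvd k x (by simpa using h)) h0).trans_eq hd

/-- A permutation representation obtained from a finite family of distinct elements stable under
the action. -/
theorem exists_permHom_of_stable {G A ι : Type*} [Group G] [MulAction G A] [Finite ι]
    (r : ι → A) (hr : Function.Injective r) (h : ∀ (g : G) i, ∃ j, g • r i = r j) :
    ∃ φ : G →* Equiv.Perm ι, ∀ g i, g • r i = r (φ g i) := by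
  choose t ht using h
  have hinj : ∀ g, Function.Injective (t g) := fun g i j hij =>
    hr (MulAction.injective g (by change g • r i = g • r j; rw [ht, ht, hij]))
  refine ⟨MonoidHom.mk' (fun g => Equiv.ofBijective (t g) (Finite.injective_iff_bijective.1 (hinj g)))
    fun a b => Equiv.ext fun i => hr ?_, fun g i => ht g i⟩
  change r (t (a * b) i) = r (t a (t b i))
  rw [← ht, ← ht, ← ht, mul_smul]

/-- In the irreducible case the roots are x, y, -x, -y. Placed at the vertices of a square with
opposite signs at opposite corners, they are permuted transitively by Galois through D₄. -/
theorem mem_compositumD4_of_biquadratic [IsAlgClosure k Ω] {x : Ω} (p q : k)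
    (h : x ^ 4 + algebraMap k Ω p * x ^ 2 + algebraMap k Ω q = 0) : x ∈ compositumOfGeneralizedType dihedralD4 k Ω := by
  have : IsAlgClosed Ω := IsAlgClosure.isAlgClosed k
  have : Normal k Ω := IsAlgClosure.normal_of_field
  have : CharZero Ω := charZero_of_injective_algebraMap (algebraMap k Ω).injective
  have hint : IsIntegral k x := Algebra.IsIntegral.isIntegral x
  let f : k[X] := X ^ 4 + C p * X ^ 2 + C q
  have hroot : ∀ y : Ω, aeval y f = y ^ 4 + algebraMap k Ω p * y ^ 2 + algebraMap k Ω q := by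
    intro y
    simp [f]
  by_cases hquad : ∃ c : k, x ^ 2 = algebraMap k Ω c
  · obtain ⟨c, hc⟩ := hquad
    exact mem_compositumD4_of_quadratic 0 (-c) (by simp [hc])
  have hmin : (minpoly k x).natDegree ≤ 2 ∨ minpoly k x = f :=
    natDegree_minpoly_le_two_or_eq_of_biquadratic hquad (Algebra.IsIntegral.isIntegral x) h
  obtain hle | hmin := hmin
  · exact mem_compositumD4_of_natDegree_minpoly_le_two hle
  -- `y ^ 2` is the other root of T² + pT + q.
  obtain ⟨y, hy⟩ := IsAlgClosed.exists_pow_nat_eq (-algebraMap k Ω p - x ^ 2) two_pos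
  have hx0 : x ≠ 0 := by
    rintro rfl
    exact hquad ⟨0, by simp⟩
  have hxy : x ^ 2 ≠ y ^ 2 := by
    intro hxy
    refine hquad ⟨-p / 2, ?_⟩
    simp only [map_div₀, map_neg, map_ofNat]
    field_simp
    linear_combination hxy + hy
  have hy0 : y ≠ 0 := by
    rintro rfl
    exact hquad ⟨-p, by simp only [map_neg]; linear_combination hy⟩
  let r : Fin 4 → Ω := ![x, y, -x, -y]
  have hr2 : ∀ i, r (i + 2) = -r i := by
    intro i
    fin_cases i <;> simp [r]
  have hr : Function.Injective r := by
    have h1 : x ≠ y := fun e => hxy (by rw [e])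
    have h2 : x ≠ -y := fun e => hxy (by rw [e, neg_sq])
    have h3 : -x ≠ y := fun e => hxy (by rw [← e, neg_sq])
    have h4 : -x ≠ -y := fun e => h1 (neg_injective e)
    have h5 : x ≠ -x := fun e => hx0 (self_eq_neg.1 e)
    have h6 : y ≠ -y := fun e => hy0 (self_eq_neg.1 e)
    intro i j
    fin_cases i <;> fin_cases j <;>
      simp [r, h1, h2, h3, h4, h5, h6, h1.symm, h2.symm, h3.symm, h5.symm, h6.symm]
  have hmem : ∀ z : Ω, aeval z f = 0 ↔ ∃ j, z = r j := by
    intro z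
    have hfac : aeval z f = (z - x) * (z + x) * ((z - y) * (z + y)) := by
      rw [hroot]
      linear_combination (z ^ 2 - x ^ 2) * hy + h
    rw [hfac]
    constructor
    · intro hz
      rcases mul_eq_zero.1 hz with hz | hz <;> rcases mul_eq_zero.1 hz with hz | hz
      · exact ⟨0, sub_eq_zero.1 hz⟩
      · exact ⟨2, eq_neg_of_add_eq_zero_left hz⟩
      · exact ⟨1, sub_eq_zero.1 hz⟩
      · exact ⟨3, eq_neg_of_add_eq_zero_left hz⟩
    · rintro ⟨j, rfl⟩
      fin_cases j <;> simp [r]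
  obtain ⟨φ, hφ⟩ := exists_permHom_of_stable (G := Ω ≃ₐ[k] Ω) r hr (by
    intro σ i
    rw [← hmem]
    change aeval (σ (r i)) f = 0
    rw [aeval_algHom_apply, (hmem _).2 ⟨i, rfl⟩, map_zero])
  have hconj : ∀ i, IsConjRoot k x (r i) := fun i =>
    (isConjRoot_iff_aeval_eq_zero hint).2 (by rw [hmin]; exact (hmem _).2 ⟨i, rfl⟩)
  have : FiniteDimensional k k⟮x⟯ := adjoin.finiteDimensional hint
  refine le_compositumOfGeneralizedType (isFieldOfGeneralizedType_of_hom dihedralD4 k⟮x⟯ φ ?_ ?_ ?_)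
    (mem_adjoin_simple_self k x)
  · refine fun σ => mem_dihedralD4_of_add_two _ fun i => hr ?_
    rw [← hφ, hr2, hr2, ← hφ]
    exact map_neg σ _
  · intro i j
    obtain ⟨σ, hσ⟩ := ((hconj i).symm.trans (hconj j)).symm.exists_algEquiv
    exact ⟨σ, hr (by rw [← hφ]; exact hσ)⟩
  · intro σ hσ z hz
    have hle : k⟮x⟯ ≤ fixedField (Subgroup.zpowers σ) := by
      rw [adjoin_simple_le_iff, mem_fixedField_iff]
      intro g hg
      have : Subgroup.zpowers σ ≤ MulAction.stabilizer (Ω ≃ₐ[k] Ω) x := by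
        rw [Subgroup.zpowers_le]
        have := hφ σ 0
        rw [hσ] at this
        exact this
      exact this hg
    exact (mem_fixedField_iff _ _).1 (hle hz) _ (Subgroup.mem_zpowers _)

end DihedralFour

/-! ### Two-division polynomial, duplication and halving -/

section TwoDivision

open WeierstrassCurve

/-- Completing the square in y; the left side vanishes exactly at the affine points equal to their
negative. -/
theorem sq_two_mul_add_eq_twoDivision {L : Type*} [Field L] (W : WeierstrassCurve.Affine L) {x y : L}
    (h : W.Equation x y) :
    (2 * y + W.a₁ * x + W.a₃) ^ 2 = 4 * x ^ 3 + W.b₂ * x ^ 2 + 2 * W.b₄ * x + W.b₆ := by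
  rw [Affine.equation_iff] at h
  simp only [b₂, b₄, b₆]
  linear_combination 4 * h

variable {L : Type*} [Field L] [DecidableEq L]

theorem two_nsmul_some_eq_zero_iff (W : WeierstrassCurve.Affine L) {x y : L}
    (h : W.Nonsingular x y) :
    2 • (Affine.Point.some x y h) = 0 ↔ 2 * y + W.a₁ * x + W.a₃ = 0 := by
  rw [two_nsmul, add_eq_zero_iff_eq_neg, Affine.Point.neg_some, Affine.Point.some.injEq,
    Affine.negY]
  constructor
  · rintro ⟨-, h⟩
    linear_combination h
  · exact fun h => ⟨rfl, by linear_combination h⟩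

theorem exists_addOrderOf_eq_two_iff (hL : (2 : L) ≠ 0) (W : WeierstrassCurve.Affine L)
    [W.IsElliptic] :
    (∃ P : W.Point, addOrderOf P = 2) ↔
      ∃ x : L, 4 * x ^ 3 + W.b₂ * x ^ 2 + 2 * W.b₄ * x + W.b₆ = 0 := by
  have : Fact (Nat.Prime 2) := ⟨Nat.prime_two⟩
  constructor
  · rintro ⟨P, hP⟩
    obtain ⟨h2, h0⟩ := addOrderOf_eq_prime_iff.1 hP
    rcases P with _ | ⟨x, y, h⟩
    · exact absurd rfl h0
    · rw [two_nsmul_some_eq_zero_iff] at h2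
      exact ⟨x, by rw [← sq_two_mul_add_eq_twoDivision W h.1, h2]; ring⟩
  · rintro ⟨x, hx⟩
    have hy : 2 * (-(W.a₁ * x + W.a₃) / 2) + W.a₁ * x + W.a₃ = 0 := by
      field_simp
      ring
    have heq : W.Equation x (-(W.a₁ * x + W.a₃) / 2) := by
      rw [Affine.equation_iff]
      simp only [b₂, b₄, b₆] at hx
      field_simp
      linear_combination -hx
    exact ⟨.some _ _ (Affine.equation_iff_nonsingular.1 heq),
      addOrderOf_eq_prime ((two_nsmul_some_eq_zero_iff W _).2 hy) (Affine.Point.some_ne_zero _)⟩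

/-- The duplication formula relative to the roots of the two-division polynomial. -/
theorem addX_self_sub_mul_sq (hL : (2 : L) ≠ 0) (W : WeierstrassCurve.Affine L) {x y e f g : L}
    (h : W.Equation x y) (hy : 2 * y + W.a₁ * x + W.a₃ ≠ 0) (h₂ : W.b₂ = -4 * (e + f + g))
    (h₄ : W.b₄ = 2 * (e * f + e * g + f * g)) (h₆ : W.b₆ = -4 * (e * f * g)) :
    (W.addX x x (W.slope x x y y) - e) * (2 * y + W.a₁ * x + W.a₃) ^ 2 =
      ((x - e) ^ 2 - (e - f) * (e - g)) ^ 2 := by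
  have hne : y ≠ W.negY x y := fun hy' => hy (by rw [Affine.negY] at hy'; linear_combination hy')
  have hs : W.slope x x y y * (2 * y + W.a₁ * x + W.a₃) =
      3 * x ^ 2 + 2 * W.a₂ * x + W.a₄ - W.a₁ * y := by
    rw [Affine.slope_of_Y_ne rfl hne, Affine.negY,
      show y - (-y - W.a₁ * x - W.a₃) = 2 * y + W.a₁ * x + W.a₃ by ring, div_mul_cancel₀ _ hy]
  have hY := sq_two_mul_add_eq_twoDivision W h
  have hb₂ : W.b₂ = W.a₁ ^ 2 + 4 * W.a₂ := rfl
  have hb₄ : W.b₄ = 2 * W.a₄ + W.a₁ * W.a₃ := rfl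
  rw [Affine.addX]
  generalize W.slope x x y y = l at hs ⊢
  set Y := 2 * y + W.a₁ * x + W.a₃ with hYdef
  -- Here 2l + a₁ is the tangent slope dY/dx on the completed-square model Y² = 4x³ + b₂x² + 2b₄x +
  -- b₆.
  have hl : (2 * l + W.a₁) * Y = 6 * x ^ 2 + W.b₂ * x + W.b₄ := by
    rw [hb₂, hb₄]
    linear_combination 2 * hs + W.a₁ * hYdef
  have h4 : 4 * ((l ^ 2 + W.a₁ * l - W.a₂ - x - x - e) * Y ^ 2) =
      4 * ((x - e) ^ 2 - (e - f) * (e - g)) ^ 2 := by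
    have : 4 * (l ^ 2 + W.a₁ * l - W.a₂ - x - x - e) =
        (2 * l + W.a₁) ^ 2 - W.b₂ - 8 * x - 4 * e := by
      rw [hb₂]
      ring
    rw [← mul_assoc, this]
    rw [h₂, h₄] at hl
    rw [h₂, h₄, h₆] at hY
    rw [h₂]
    linear_combination ((2 * l + W.a₁) * Y + 6 * x ^ 2 + -4 * (e + f + g) * x +
      2 * (e * f + e * g + f * g)) * hl + (4 * (e + f + g) - 8 * x - 4 * e) * hY
  have h40 : (4 : L) ≠ 0 := by
    rw [show (4 : L) = 2 * 2 by norm_num]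
    exact mul_ne_zero hL hL
  exact mul_left_cancel₀ h40 h4

/-- If `4 • (x, y) = 0`, then either `(x, y)` is a two-torsion point, or its double is the
two-torsion point with abscissa one of the roots `e`, `f`, `g`. -/
theorem four_nsmul_eq_zero_cases (hL : (2 : L) ≠ 0) (W : WeierstrassCurve.Affine L)
    {x y e f g : L} (h : W.Nonsingular x y) (h4 : 4 • Affine.Point.some x y h = 0)
    (h₂ : W.b₂ = -4 * (e + f + g)) (h₄ : W.b₄ = 2 * (e * f + e * g + f * g))
    (h₆ : W.b₆ = -4 * (e * f * g)) :
    2 * y + W.a₁ * x + W.a₃ = 0 ∨ (x - e) ^ 2 = (e - f) * (e - g) ∨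
      (x - f) ^ 2 = (f - e) * (f - g) ∨ (x - g) ^ 2 = (g - e) * (g - f) := by
  by_cases hy : 2 * y + W.a₁ * x + W.a₃ = 0
  · exact Or.inl hy
  refine Or.inr ?_
  have hne : y ≠ W.negY x y := fun hy' => hy (by rw [Affine.negY] at hy'; linear_combination hy')
  rw [show 4 = 2 * 2 from rfl, mul_nsmul, two_nsmul (Affine.Point.some x y h),
    Affine.Point.add_self_of_Y_ne hne, two_nsmul_some_eq_zero_iff] at h4
  have hroot := sq_two_mul_add_eq_twoDivision W
    (Affine.equation_add h.1 h.1 fun hxy => hne hxy.2)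
  rw [h4, h₂, h₄, h₆] at hroot
  have he := addX_self_sub_mul_sq hL W h.1 hy h₂ h₄ h₆
  have hf := addX_self_sub_mul_sq (e := f) (f := e) (g := g) hL W h.1 hy
    (by rw [h₂]; ring) (by rw [h₄]; ring) (by rw [h₆]; ring)
  have hg := addX_self_sub_mul_sq (e := g) (f := e) (g := f) hL W h.1 hy
    (by rw [h₂]; ring) (by rw [h₄]; ring) (by rw [h₆]; ring)
  generalize W.addX x x (W.slope x x y y) = z at hroot he hf hg
  -- The abscissa z of the doubled point is a root of the two-division cubic, so it is e, f or g;
  -- the duplication formula at that root then gives a vanishing square.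
  have hprod : (2 * 2 : L) * ((z - e) * ((z - f) * (z - g))) = 0 := by
    linear_combination -hroot
  have hzero : ∀ t r : L, t * (2 * y + W.a₁ * x + W.a₃) ^ 2 = r ^ 2 → t = 0 → r = 0 := by
    rintro t r htr rfl
    exact pow_eq_zero_iff two_ne_zero |>.1 (by rw [← htr, zero_mul])
  rcases mul_eq_zero.1 ((mul_eq_zero.1 hprod).resolve_left (mul_ne_zero hL hL)) with h | h
  · exact Or.inl (sub_eq_zero.1 (hzero _ _ he h))
  · rcases mul_eq_zero.1 h with h | h
    · exact Or.inr (Or.inl (sub_eq_zero.1 (hzero _ _ hf h)))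
    · exact Or.inr (Or.inr (sub_eq_zero.1 (hzero _ _ hg h)))

end TwoDivision

/-- If `u ^ 2 = s ^ 2 * t ^ 2` and `Y ^ 2 = 4 u (u + s ^ 2) (u + t ^ 2)`, then `u` and `Y` are
polynomials in `s` and `t`. -/
theorem mem_of_sq_eq_of_sq_eq {k L : Type*} [Field k] [Field L] [Algebra k L]
    (F : IntermediateField k L) {s t u Y : L} (hs : s ∈ F) (ht : t ∈ F)
    (hu : u ^ 2 = s ^ 2 * t ^ 2) (hY : Y ^ 2 = 4 * (u * (u + s ^ 2) * (u + t ^ 2))) :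
    u ∈ F ∧ Y ∈ F := by
  have key : ∀ t ∈ F, u = s * t → Y ^ 2 = 4 * (u * (u + s ^ 2) * (u + t ^ 2)) → u ∈ F ∧ Y ∈ F := by
    rintro t ht rfl hY
    -- With u = st, the factors u + s² = s(s + t) and u + t² = t(s + t) make the right side a
    -- perfect square.
    have hsq : Y ^ 2 = (2 * (s * t) * (s + t)) ^ 2 := by
      rw [hY]
      ring
    have h2 : (2 : L) ∈ F := by exact_mod_cast natCast_mem F 2
    have hmem : 2 * (s * t) * (s + t) ∈ F :=
      mul_mem (mul_mem h2 (mul_mem hs ht)) (add_mem hs ht)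
    refine ⟨mul_mem hs ht, ?_⟩
    rcases sq_eq_sq_iff_eq_or_eq_neg.1 hsq with h | h
    · exact h ▸ hmem
    · exact h ▸ neg_mem hmem
  rcases sq_eq_sq_iff_eq_or_eq_neg.1 (hu.trans (mul_pow s t 2).symm) with h | h
  · exact key t ht h hY
  · exact key (-t) (neg_mem ht) (by rw [h]; ring) (by rw [hY]; ring)

/-! ### Coordinates and torsion of points over subfields -/

section Points

open WeierstrassCurve

variable {k Ω : Type*} [Field k] [Field Ω] [DecidableEq Ω] [Algebra k Ω]

theorem some_mem_pointsOver_iff (E : WeierstrassCurve k) (F : IntermediateField k Ω) {x y : Ω}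
    (h : (E.toAffine.baseChange Ω).Nonsingular x y) :
    Affine.Point.some x y h ∈ pointsOver E F ↔ x ∈ F ∧ y ∈ F := by
  constructor
  · rintro ⟨P, hP⟩
    rcases P with _ | ⟨a, b, hab⟩
    · exact absurd hP.symm (Affine.Point.some_ne_zero h)
    · rw [Affine.Point.map_some, Affine.Point.some.injEq] at hP
      exact ⟨hP.1 ▸ a.2, hP.2 ▸ b.2⟩
  · rintro ⟨hx, hy⟩
    exact ⟨.some (⟨x, hx⟩ : F) (⟨y, hy⟩ : F)
      ((E.toAffine.baseChange_nonsingular F.val.injective _ _).1 h), rfl⟩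

theorem mem_torsionPoints_iff (E : WeierstrassCurve k) (n : ℕ)
    (P : (E.toAffine.baseChange Ω).Point) : P ∈ torsionPoints Ω E n ↔ n • P = 0 := by
  rw [← natCast_zsmul]
  rfl

theorem torsionPoints_le_of_dvd (E : WeierstrassCurve k) {m n : ℕ} (h : m ∣ n) :
    torsionPoints Ω E m ≤ torsionPoints Ω E n := by
  obtain ⟨d, rfl⟩ := h
  intro P hP
  rw [mem_torsionPoints_iff] at hP ⊢
  rw [mul_comm, mul_nsmul', hP, nsmul_zero]

end Points

/-! ### Roots of the cubic and 4-torsion over the D₄-compositum -/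

section Dichotomy

open WeierstrassCurve Polynomial

variable {k Ω : Type*} [Field k] [Field Ω] [Algebra k Ω]

/-- A cubic without a root in `k` is irreducible, which would give `x` degree 3; this is
incompatible with being fixed by all fourth powers. -/
theorem exists_root_of_cubic_root_mem_compositumD4 [CharZero k] [IsAlgClosure k Ω] {x : Ω}
    (hx : x ∈ compositumOfGeneralizedType dihedralD4 k Ω) (a b c : k)
    (h : 4 * x ^ 3 + algebraMap k Ω a * x ^ 2 + algebraMap k Ω b * x + algebraMap k Ω c = 0) :
    ∃ e : k, 4 * e ^ 3 + a * e ^ 2 + b * e + c = 0 := by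
  have : Normal k Ω := IsAlgClosure.normal_of_field
  by_contra! hne
  let f : k[X] := X ^ 3 + C (a / 4) * X ^ 2 + C (b / 4) * X + C (c / 4)
  have hd : f.natDegree = 3 := by simp only [f]; compute_degree!
  have hmon : f.Monic := by simp only [f]; monicity!
  have hirr : Irreducible f := by
    refine irreducible_of_degree_le_three_of_not_isRoot ?_ fun e he => hne e ?_
    · rw [hd]
      decide
    · simp only [f, IsRoot.def, eval_add, eval_mul, eval_pow, eval_X, eval_C] at he
      linear_combination 4 * he
  have hroot : aeval x f = 0 := by
    have : CharZero Ω := charZero_of_injective_algebraMap (algebraMap k Ω).injective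
    simp only [f, map_add, map_mul, map_pow, aeval_X, aeval_C, map_div₀, map_ofNat]
    field_simp
    linear_combination h
  have hmin := minpoly.eq_of_irreducible_of_monic hirr hroot hmon
  exact natDegree_minpoly_ne_three_of_pow_four (k := k) (x := x)
    (fun σ => pow_apply_eq_of_mem_compositum dihedralD4 pow_four_eq_one_of_mem_dihedralD4 σ hx)
    (hmin ▸ hd)

theorem mem_compositumD4_of_sq_quadratic [CharZero k] [IsAlgClosure k Ω] {s t : Ω} (p q : k)
    (hs : s ^ 2 = t) (h : t ^ 2 + algebraMap k Ω p * t + algebraMap k Ω q = 0) :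
    s ∈ compositumOfGeneralizedType dihedralD4 k Ω :=
  mem_compositumD4_of_biquadratic p q (by rw [← h, ← hs]; ring)

variable [DecidableEq Ω]

theorem torsionPoints_four_le_pointsOver_compositumD4 [CharZero k] [IsAlgClosure k Ω]
    (E : WeierstrassCurve k) {e₀ : k}
    (he₀ : 4 * e₀ ^ 3 + E.b₂ * e₀ ^ 2 + 2 * E.b₄ * e₀ + E.b₆ = 0) :
    torsionPoints Ω E 4 ≤ pointsOver E (compositumOfGeneralizedType dihedralD4 k Ω) := by
  have : Normal k Ω := IsAlgClosure.normal_of_field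
  have : IsAlgClosed Ω := IsAlgClosure.isAlgClosed k
  have : CharZero Ω := charZero_of_injective_algebraMap (algebraMap k Ω).injective
  set F := compositumOfGeneralizedType dihedralD4 k Ω
  have hL : (2 : Ω) ≠ 0 := two_ne_zero
  have h2F : (2 : Ω) ∈ F := by exact_mod_cast natCast_mem F 2
  let W : WeierstrassCurve.Affine Ω := E.toAffine.baseChange Ω
  -- the two-division polynomial is `4 (X - e₀) (X ^ 2 + c X + d)`
  let c : k := E.b₂ / 4 + e₀
  let d : k := E.b₄ / 2 + c * e₀
  let e : Ω := algebraMap k Ω e₀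
  obtain ⟨r, hr⟩ := IsAlgClosed.exists_pow_nat_eq (algebraMap k Ω (c ^ 2 - 4 * d)) two_pos
  let f : Ω := (-algebraMap k Ω c + r) / 2
  let g : Ω := (-algebraMap k Ω c - r) / 2
  have hr' : r ^ 2 = algebraMap k Ω c ^ 2 - 4 * algebraMap k Ω d := by
    rw [hr, map_sub, map_mul, map_pow, map_ofNat]
  have hfg : f + g = -algebraMap k Ω c := by simp only [f, g]; field_simp; ring
  have hfg' : f * g = algebraMap k Ω d := by
    simp only [f, g]
    field_simp
    linear_combination -hr'
  clear_value f g
  have hb₂ : E.b₂ = 4 * (c - e₀) := by simp only [c]; ring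
  have hb₄ : E.b₄ = 2 * (d - c * e₀) := by simp only [d]; ring
  have hb₆ : E.b₆ = -4 * e₀ * d := by
    linear_combination he₀ - e₀ ^ 2 * hb₂ - 2 * e₀ * hb₄
  have h₂ : W.b₂ = -4 * (e + f + g) := by
    rw [show W.b₂ = algebraMap k Ω E.b₂ from E.map_b₂ _, hb₂]
    simp only [map_mul, map_sub, map_ofNat]
    linear_combination 4 * hfg
  have h₄ : W.b₄ = 2 * (e * f + e * g + f * g) := by
    rw [show W.b₄ = algebraMap k Ω E.b₄ from E.map_b₄ _, hb₄]
    simp only [map_mul, map_sub, map_ofNat]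
    linear_combination -2 * e * hfg - 2 * hfg'
  have h₆ : W.b₆ = -4 * (e * f * g) := by
    rw [show W.b₆ = algebraMap k Ω E.b₆ from E.map_b₆ _, hb₆]
    simp only [map_mul, map_neg, map_ofNat]
    linear_combination 4 * e * hfg'
  have hroot : ∀ z : Ω, (z - f) * (z - g) =
      z ^ 2 + algebraMap k Ω c * z + algebraMap k Ω d := by
    intro z
    linear_combination hfg' - z * hfg
  have heF : e ∈ F := F.algebraMap_mem e₀
  have hfF : f ∈ F := mem_compositumD4_of_quadratic c d (by rw [← hroot]; ring)
  have hgF : g ∈ F := mem_compositumD4_of_quadratic c d (by rw [← hroot]; ring)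
  -- Substituting z = e - T in the quadratic with roots f, g gives a quadratic over `k` for T = s²,
  -- hence a biquadratic for s.
  have hsub : ∀ z s : Ω, (z - f) * (z - g) = 0 → s ^ 2 = e - z → s ∈ F := by
    intro z s hz hs
    rw [hroot] at hz
    refine mem_compositumD4_of_sq_quadratic (-(c + 2 * e₀)) (d + c * e₀ + e₀ ^ 2) hs ?_
    simp only [map_neg, map_add, map_mul, map_pow, map_ofNat]
    linear_combination hz
  have hsub' : ∀ z s : Ω, (z - f) * (z - g) = 0 → s ^ 2 = z - e → s ∈ F := by
    intro z s hz hs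
    rw [hroot] at hz
    refine mem_compositumD4_of_sq_quadratic (c + 2 * e₀) (d + c * e₀ + e₀ ^ 2) hs ?_
    simp only [map_add, map_mul, map_pow, map_ofNat]
    linear_combination hz
  -- Here t is ±(f - g), and (f - g)² is the discriminant c² - 4d, so s⁴ lies in `k`.
  have hdiff : ∀ s t : Ω, s ^ 2 = t → t ^ 2 = (f - g) ^ 2 → s ∈ F := by
    intro s t hs ht
    refine mem_compositumD4_of_sq_quadratic 0 (4 * d - c ^ 2) hs ?_
    simp only [map_zero, map_sub, map_mul, map_pow, map_ofNat]
    rw [ht]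
    linear_combination (f + g - algebraMap k Ω c) * hfg - 4 * hfg'
  have hsqrt : ∀ a : Ω, ∃ s, s ^ 2 = a := fun a => IsAlgClosed.exists_pow_nat_eq a two_pos
  -- Halving at a root e, uniform in the three roots: with u = x - e, s² = e - f and t² = e - g, one
  -- has x - f = u + s² and x - g = u + t².
  have hhalf : ∀ x Y e f g : Ω, e ∈ F → (∀ s, s ^ 2 = e - f → s ∈ F) →
      (∀ s, s ^ 2 = e - g → s ∈ F) → (x - e) ^ 2 = (e - f) * (e - g) →
      Y ^ 2 = 4 * ((x - e) * (x - f) * (x - g)) → x ∈ F ∧ Y ∈ F := by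
    intro x Y e f g he hf hg hx hY
    obtain ⟨s, hs⟩ := hsqrt (e - f)
    obtain ⟨t, ht⟩ := hsqrt (e - g)
    obtain ⟨hu, hY⟩ := mem_of_sq_eq_of_sq_eq F (u := x - e) (hf s hs) (hg t ht)
      (by rw [hs, ht, hx]) (by rw [hY, hs, ht]; ring)
    exact ⟨by simpa using add_mem hu he, hY⟩
  intro P hP
  rcases P with _ | ⟨x, y, h⟩
  · exact zero_mem _
  rw [mem_torsionPoints_iff] at hP
  rw [some_mem_pointsOver_iff]
  have hY : (2 * y + W.a₁ * x + W.a₃) ^ 2 = 4 * ((x - e) * (x - f) * (x - g)) := by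
    rw [sq_two_mul_add_eq_twoDivision W h.1, h₂, h₄, h₆]
    ring
  have hmem : x ∈ F ∧ 2 * y + W.a₁ * x + W.a₃ ∈ F := by
    rcases four_nsmul_eq_zero_cases hL W h hP h₂ h₄ h₆ with h | h | h | h
    · rw [h] at hY ⊢
      refine ⟨?_, zero_mem _⟩
      have h0 : (x - e) * (x - f) * (x - g) = 0 := by
        simpa using hY.symm
      rcases mul_eq_zero.1 h0 with h | h
      · rcases mul_eq_zero.1 h with h | h
        · rwa [sub_eq_zero.1 h]
        · rwa [sub_eq_zero.1 h]
      · rwa [sub_eq_zero.1 h]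
    · exact hhalf x _ e f g heF (fun s => hsub f s (by ring)) (fun s => hsub g s (by ring)) h hY
    · exact hhalf x _ f e g hfF (fun s => hsub' f s (by ring))
        (fun s hs => hdiff s _ hs rfl) h (by rw [hY]; ring)
    · exact hhalf x _ g e f hgF (fun s => hsub' g s (by ring))
        (fun s hs => hdiff s _ hs (by ring)) h (by rw [hY]; ring)
  refine ⟨hmem.1, ?_⟩
  have ha₁ : W.a₁ ∈ F := F.algebraMap_mem E.a₁
  have ha₃ : W.a₃ ∈ F := F.algebraMap_mem E.a₃
  have hy : y = (2 * y + W.a₁ * x + W.a₃ - W.a₁ * x - W.a₃) / 2 := by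
    field_simp
    ring
  rw [hy]
  exact div_mem (sub_mem (sub_mem hmem.2 (mul_mem ha₁ hmem.1)) ha₃) h2F

end Dichotomy

/-! ### The dichotomy over ℚ -/

theorem proposition5p11 (Ω : Type*) [Field Ω] [DecidableEq Ω] [Algebra ℚ Ω] [IsAlgClosure ℚ Ω]
    (E : WeierstrassCurve ℚ) [E.IsElliptic] :
    Xor
      (pointsOver E (fieldQD4Inf Ω) ⊓ torsionPoints Ω E 2 = ⊥)
      (torsionPoints Ω E 4 ≤ pointsOver E (fieldQD4Inf Ω)) ∧
    (torsionPoints Ω E 4 ≤ pointsOver E (fieldQD4Inf Ω) ↔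
      ∃ P : E.toAffine.Point, addOrderOf P = 2) := by
  have : IsAlgClosed Ω := IsAlgClosure.isAlgClosed ℚ
  have : CharZero Ω := charZero_of_injective_algebraMap (algebraMap ℚ Ω).injective
  let W : WeierstrassCurve.Affine Ω := E.toAffine.baseChange Ω
  have hb₂ : W.b₂ = algebraMap ℚ Ω E.b₂ := E.map_b₂ _
  have hb₄ : W.b₄ = algebraMap ℚ Ω E.b₄ := E.map_b₄ _
  have hb₆ : W.b₆ = algebraMap ℚ Ω E.b₆ := E.map_b₆ _
  have hiff := exists_addOrderOf_eq_two_iff (two_ne_zero : (2 : ℚ) ≠ 0) E.toAffine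
  have hfull : (∃ P : E.toAffine.Point, addOrderOf P = 2) →
      torsionPoints Ω E 4 ≤ pointsOver E (fieldQD4Inf Ω) := fun h => by
    obtain ⟨e, he⟩ := hiff.1 h
    exact torsionPoints_four_le_pointsOver_compositumD4 E he
  have htriv : (¬∃ P : E.toAffine.Point, addOrderOf P = 2) →
      pointsOver E (fieldQD4Inf Ω) ⊓ torsionPoints Ω E 2 = ⊥ := fun h => by
    rw [eq_bot_iff]
    rintro P ⟨hPF, hP⟩
    rcases P with _ | ⟨x, y, hxy⟩
    · exact zero_mem _
    exfalso
    have hx := ((some_mem_pointsOver_iff E _ hxy).1 hPF).1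
    have h2 := (two_nsmul_some_eq_zero_iff W hxy).1 ((mem_torsionPoints_iff E 2 _).1 hP)
    have hroot := sq_two_mul_add_eq_twoDivision W hxy.1
    rw [h2, hb₂, hb₄, hb₆] at hroot
    exact h (hiff.2 (exists_root_of_cubic_root_mem_compositumD4 hx E.b₂ (2 * E.b₄) E.b₆
      (by rw [map_mul, map_ofNat]; linear_combination -hroot)))
  -- Over the algebraically closed Ω the two-division cubic has a root, which gives a point of order
  -- 2; it lies in E[4], so the 2-torsion over the compositum is nonzero.
  have hnot : torsionPoints Ω E 4 ≤ pointsOver E (fieldQD4Inf Ω) →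
      pointsOver E (fieldQD4Inf Ω) ⊓ torsionPoints Ω E 2 ≠ ⊥ := fun h4 hbot => by
    have : W.IsElliptic := inferInstanceAs (E.map (algebraMap ℚ Ω)).IsElliptic
    let f : Polynomial Ω := ⟨4, W.b₂, 2 * W.b₄, W.b₆⟩ |> Cubic.toPoly
    have hdeg : f.degree = 3 := Cubic.degree_of_a_ne_zero (by simp)
    obtain ⟨x, hx⟩ := IsAlgClosed.exists_root f (by rw [hdeg]; decide)
    obtain ⟨P, hP⟩ := (exists_addOrderOf_eq_two_iff (two_ne_zero : (2 : Ω) ≠ 0) W).2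
      ⟨x, by simpa [f, Cubic.toPoly] using hx⟩
    have hP2 : P ∈ torsionPoints Ω E 2 :=
      (mem_torsionPoints_iff E 2 P).2 (hP ▸ addOrderOf_nsmul_eq_zero P)
    have hP0 : P ∈ (⊥ : AddSubgroup (E.toAffine.baseChange Ω).Point) :=
      hbot ▸ ⟨h4 (torsionPoints_le_of_dvd E (by norm_num) hP2), hP2⟩
    rw [AddSubgroup.mem_bot] at hP0
    rw [hP0, addOrderOf_zero] at hP
    exact absurd hP (by norm_num)
  by_cases h : ∃ P : E.toAffine.Point, addOrderOf P = 2
  · exact ⟨Or.inr ⟨hfull h, hnot (hfull h)⟩, fun _ => h, fun _ => hfull h⟩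
  · exact ⟨Or.inl ⟨htriv h, fun h4 => hnot h4 (htriv h)⟩, fun h4 => absurd (htriv h) (hnot h4),
      fun h' => absurd h' h⟩
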